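/- A stochastic cellular automaton (CA) is a tuple $A=(Q,R,V,V',f)$ with finite nonempty sets $Q$ (states) and $R$ (random symbols), finite sets $V,V'\subset\mathbb Z$ and a local function $f:Q^{V}\times R^{V'}\to Q$. Its explicit global function is $F:Q^{\mathbb Z}\times R^{\mathbb Z}\to Q^{\mathbb Z}$, $F(c,s)_z=f\big((c_{z+v})_{v\in V},(s_{z+v'})_{v'\in V'}\big)$, and its stochastic global function $S_F$ maps $c\in Q^{\mathbb Z}$ to the law of $F(c,s)$, where $s$ is uniformly distributed on $R^{\mathbb Z}$. $A$ is a plain probabilistic CA (PCA) if $V'=\{0\}$. $\mathrm{PF}(A)$ denotes the set of prime factors of $|R|$. *Rescaling.* For $m,t\ge1$ and $k\in\mathbb Z$, $A^{\langle m,t,k\rangle}$ is the stochastic CA with states $Q^m$, random symbols $(R^m)^t$ and explicit global function $(c,s)\mapsto b_m\circ\sigma_k\circ F^t\big(b_m^{-1}(c),b_m^{-1}(s^1),\dots,b_m^{-1}(s^t)\big)$, where $F^0(c)=c$, $F^{j+1}(c,s^1,\dots,s^{j+1})=F(F^j(c,s^1,\dots,s^j),s^{j+1})$, $\sigma_k(c)_z=c_{z+k}$,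 $b_m(c)_z=(c_{mz},\dots,c_{mz+m-1})$, and $s^1,\dots,s^t$ are the $t$ components of $s$. *Trimming.* If $i:Q'\to Q$ is injective and $F(i(Q')^{\mathbb Z}\times R^{\mathbb Z})\subseteq i(Q')^{\mathbb Z}$, the $i$-restriction of $A$ is the stochastic CA with states $Q'$ and random symbols $R$ obtained by transporting $F$ along the cell-by-cell extension of $i$. If $\pi:Q\to Q'$ is surjective with cell-by-cell extension $\Pi$, and $\Pi(F(c,s))=\Pi(F(c',s))$ whenever $\Pi(c)=\Pi(c')$, the $\pi$-projection of $A$ is the stochastic CA with states $Q'$ and random symbols $R$ and explicit global function $(\Pi(c),s)\mapsto\Pi(F(c,s))$. *Simulation.* $A_1\preceq_i A_2$ (resp. $A_1\preceq_m A_2$) if there are $m_1,m_2,t_1,t_2\ge1$ and $k_1,k_2\in\mathbb Z$ such that $A_1^{\langle m_1,t_1,k_1\rangle}$ has the same stochastic global function as some restriction (resp. some projection of a restriction) of $A_2^{\langle m_2,t_2,k_2\rangle}$. **Theorem.** Let $P$ be a finite set of prime numbers. 1. There is a PCA $U_P$ with $\mathrm{PF}(U_P)=P$ such that every stochastic CA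 $A$ with $\mathrm{PF}(A)\subseteq P$ satisfies $A\preceq_i U_P$ and $A\preceq_m U_P$. 2. (Optimality.) For every prime $p\notin P$ there is a stochastic CA $A$ with $\mathrm{PF}(A)=\{p\}$ such that no stochastic CA $U$ with $\mathrm{PF}(U)\subseteq P$ satisfies $A\preceq_i U$ or $A\preceq_m U$. In particular, $U_P$ does not simulate all stochastic CA whose prime factors lie in any set of primes not contained in $P$. -/

import Mathlib

open MeasureTheory
open scoped Pointwise

noncomputable section

/-- A stochastic cellular automaton on the line: finite nonempty sets `Q` of states and `R` of
random symbols, finite neighborhoods `V`, `V'` and a local transition function. -/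
structure StochCA where
  Q : Type
  R : Type
  [finiteQ : Finite Q]
  [nonemptyQ : Nonempty Q]
  [finiteR : Finite R]
  [nonemptyR : Nonempty R]
  V : Finset ℤ
  V' : Finset ℤ
  f : (V → Q) → (V' → R) → Q

namespace StochCA

attribute [instance] finiteQ nonemptyQ finiteR nonemptyR

/-- States and random symbols carry the discrete σ-algebra; configurations carry the product one,
which is the Borel σ-algebra of the Cantor topology. -/
instance instMeasurableSpaceQ (A : StochCA) : MeasurableSpace A.Q := ⊤

instance instMeasurableSpaceR (A : StochCA) : MeasurableSpace A.R := ⊤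

instance instDiscreteQ (A : StochCA) : DiscreteMeasurableSpace A.Q := ⟨fun _ => trivial⟩

instance instDiscreteR (A : StochCA) : DiscreteMeasurableSpace A.R := ⟨fun _ => trivial⟩

/-- Plain probabilistic cellular automaton: each cell uses its own random symbol only. -/
def IsPCA (A : StochCA) : Prop := A.V' = {0}

/-- The set of prime factors of the size of the random alphabet. -/
def PF (A : StochCA) : Finset ℕ := (Nat.card A.R).primeFactors

/-- The explicit global function. -/
def global (A : StochCA) (c : ℤ → A.Q) (s : ℤ → A.R) : ℤ → A.Q :=
  fun z => A.f (fun v => c (z + v)) (fun v => s (z + v))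

/-- The iterates of the explicit global function, fed with `t` random configurations. -/
def iter (A : StochCA) : (t : ℕ) → (ℤ → A.Q) → (Fin t → ℤ → A.R) → ℤ → A.Q
  | 0, c, _ => c
  | t + 1, c, s => A.global (A.iter t c (fun j => s j.castSucc)) (s (Fin.last t))

/-- The uniform probability measure on the random configurations of `A`. -/
def randomSource (A : StochCA) : Measure (ℤ → A.R) :=
  Measure.infinitePi fun _ : ℤ => ProbabilityTheory.uniformOn (Set.univ : Set A.R)

/-- The stochastic global function: the law of the image of `c` when the random configuration is
uniform. -/
def stochGlobal (A : StochCA) (c : ℤ → A.Q) : Measure (ℤ → A.Q) :=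
  A.randomSource.map (A.global c)

theorem measurable_global (A : StochCA) (c : ℤ → A.Q) : Measurable (A.global c) := by
  refine measurable_pi_lambda _ fun z => ?_
  have h : Measurable (A.f fun v => c (z + v)) := measurable_of_finite _
  exact h.comp (measurable_pi_lambda _ fun v => measurable_pi_apply _)

/-- The value on the cylinder of the word `u` at position `z`. -/
theorem stochGlobal_cylinder (A : StochCA) (c : ℤ → A.Q) (u : List A.Q) (z : ℤ) :
    A.stochGlobal c {d | ∀ x : Fin u.length, d (z + (x : ℕ)) = u[x]} =
      A.randomSource {s | ∀ x : Fin u.length, A.global c s (z + (x : ℕ)) = u[x]} := by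
  rw [stochGlobal, Measure.map_apply (A.measurable_global c)]
  · rfl
  · have h : ∀ x : Fin u.length, MeasurableSet {d : ℤ → A.Q | d (z + (x : ℕ)) = u[x]} :=
      fun x => (measurable_pi_apply (X := fun _ : ℤ => A.Q) (z + (x : ℕ)))
        (MeasurableSet.of_discrete (s := ({u[x]} : Set A.Q)))
    convert MeasurableSet.iInter h using 1
    ext d
    simp

/-! ### Trimming operations -/

/-- `i` is injective and `i(Q')^ℤ` is stable under the explicit global function. -/
def CanRestrict (A : StochCA) {Q' : Type} (i : Q' → A.Q) : Prop :=
  Function.Injective i ∧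
    ∀ (c : ℤ → A.Q) (s : ℤ → A.R), (∀ z, c z ∈ Set.range i) → ∀ z, A.global c s z ∈ Set.range i

/-- The `i`-restriction (meaningful when `A.CanRestrict i`, see `global_restrict`). -/
def restrict (A : StochCA) {Q' : Type} [Finite Q'] [Nonempty Q'] (i : Q' → A.Q) : StochCA where
  Q := Q'
  R := A.R
  V := A.V
  V' := A.V'
  f := fun x s => Function.invFun i (A.f (fun v => i (x v)) s)

theorem global_restrict (A : StochCA) {Q' : Type} [Finite Q'] [Nonempty Q'] (i : Q' → A.Q)
    (h : A.CanRestrict i) (c : ℤ → Q') (s : ℤ → A.R) :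
    (fun z => i ((A.restrict i).global c s z)) = A.global (fun z => i (c z)) s := by
  funext z
  exact Function.invFun_eq (h.2 (fun z => i (c z)) s (fun z => ⟨c z, rfl⟩) z)

/-- `π` is surjective and compatible with the explicit global function. -/
def CanProject (A : StochCA) {Q' : Type} (π : A.Q → Q') : Prop :=
  Function.Surjective π ∧
    ∀ (s : ℤ → A.R) (c c' : ℤ → A.Q), (∀ z, π (c z) = π (c' z)) →
      ∀ z, π (A.global c s z) = π (A.global c' s z)

/-- The `π`-projection (meaningful when `A.CanProject π`, see `global_project`). -/
def project (A : StochCA) {Q' : Type} [Finite Q'] [Nonempty Q'] (π : A.Q → Q') : StochCA where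
  Q := Q'
  R := A.R
  V := A.V
  V' := A.V'
  f := fun x s => π (A.f (fun v => Function.invFun π (x v)) s)

theorem global_project (A : StochCA) {Q' : Type} [Finite Q'] [Nonempty Q'] (π : A.Q → Q')
    (h : A.CanProject π) (c : ℤ → A.Q) (s : ℤ → A.R) :
    (A.project π).global (fun z => π (c z)) s = fun z => π (A.global c s z) := by
  funext z
  exact h.2 s (fun z => Function.invFun π (π (c z))) c
    (fun z => Function.invFun_eq ⟨c z, rfl⟩) z

/-- `A₁` is a stochastic subautomaton of `A₂`. -/
def StochSub (A₁ A₂ : StochCA) : Prop :=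
  ∃ i : A₁.Q → A₂.Q, A₂.CanRestrict i ∧ A₁.stochGlobal = (A₂.restrict i).stochGlobal

/-- `A₁` has the stochastic global function of a projection of a restriction of `A₂`. -/
def StochMix (A₁ A₂ : StochCA) : Prop :=
  ∃ (Q' : Type) (_ : Finite Q') (_ : Nonempty Q') (i : Q' → A₂.Q) (π : Q' → A₁.Q),
    A₂.CanRestrict i ∧ (A₂.restrict i).CanProject π ∧
      A₁.stochGlobal = ((A₂.restrict i).project (Q' := A₁.Q) π).stochGlobal

/-! ### Rescaling -/

/-- Translation of configurations. -/
def shift {S : Type} (k : ℤ) (c : ℤ → S) : ℤ → S := fun z => c (z + k)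

/-- The packing map: the cells `m z, …, m z + m - 1` form the block `z`. -/
def pack {S : Type} (m : ℕ) (c : ℤ → S) : ℤ → Fin m → S := fun z j => c (m * z + (j : ℕ))

/-- The inverse of the packing map. -/
def unpack {S : Type} (m : ℕ) [NeZero m] (c : ℤ → Fin m → S) : ℤ → S :=
  fun z => c (z / m) ⟨(z % m).toNat, by
    have hm : (0 : ℤ) < m := by exact_mod_cast Nat.pos_of_neZero m
    have h1 := Int.emod_nonneg z hm.ne'
    have h2 := Int.emod_lt_of_pos z hm
    omega⟩

theorem unpack_pack {S : Type} (m : ℕ) [NeZero m] (c : ℤ → S) : unpack m (pack m c) = c := by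
  funext z
  have hm : (0 : ℤ) < m := by exact_mod_cast Nat.pos_of_neZero m
  have h1 := Int.emod_nonneg z hm.ne'
  simp only [unpack, pack, Int.toNat_of_nonneg h1]
  rw [Int.mul_ediv_add_emod]

theorem pack_unpack {S : Type} (m : ℕ) [NeZero m] (c : ℤ → Fin m → S) :
    pack m (unpack m c) = c := by
  funext z j
  have hm : (0 : ℤ) < m := by exact_mod_cast Nat.pos_of_neZero m
  have hj : ((j : ℕ) : ℤ) < m := by exact_mod_cast j.2
  have h1 : ((m : ℤ) * z + (j : ℕ)) / m = z := by
    rw [Int.mul_add_ediv_left _ _ hm.ne', Int.ediv_eq_zero_of_lt (by positivity) hj, add_zero]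
  have h2 : ((m : ℤ) * z + (j : ℕ)) % m = (j : ℕ) := by
    rw [Int.mul_add_emod_self_left, Int.emod_eq_of_lt (by positivity) hj]
  simp only [pack, unpack, h1, h2, Int.toNat_natCast]

/-- The explicit global function of the rescaling with parameters `(m, t, k)`: unpack, iterate `t`
times, translate by `k`, pack. -/
def rescaleGlobal (A : StochCA) (m t : ℕ) [NeZero m] (k : ℤ) (c : ℤ → Fin m → A.Q)
    (s : ℤ → Fin t → Fin m → A.R) : ℤ → Fin m → A.Q :=
  pack m (shift k (A.iter t (unpack m c) (fun j => unpack m (fun z => s z j))))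

/-- Relative positions of the states on which `t` steps depend. -/
def iterV (A : StochCA) : ℕ → Finset ℤ
  | 0 => {0}
  | t + 1 => A.V + A.iterV t

/-- Relative positions of the random symbols on which `t` steps depend. -/
def iterV' (A : StochCA) : ℕ → Finset ℤ
  | 0 => ∅
  | t + 1 => A.V' ∪ (A.V + A.iterV' t)

/-- Relative positions of the blocks met by the cells `j + k + v`, `0 ≤ j < m`, `v ∈ N`. -/
def blockNbhd (m : ℕ) (k : ℤ) (N : Finset ℤ) : Finset ℤ :=
  (Finset.range m ×ˢ N).image fun p => ((p.1 : ℤ) + k + p.2) / m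

/-- Extend a pattern to a configuration, arbitrarily outside of its support. -/
def extend {S : Type} [Nonempty S] {N : Finset ℤ} (x : N → S) : ℤ → S :=
  fun z => if h : z ∈ N then x ⟨z, h⟩ else Classical.arbitrary S

/-- The rescaling of `A` with parameters `(m, t, k)`; its explicit global function is
`rescaleGlobal`, see `global_rescale`. -/
def rescale (A : StochCA) (m t : ℕ) [NeZero m] (k : ℤ) : StochCA where
  Q := Fin m → A.Q
  R := Fin t → Fin m → A.R
  V := blockNbhd m k (A.iterV t)
  V' := blockNbhd m k (A.iterV' t)
  f := fun x s => A.rescaleGlobal m t k (extend x) (extend s) 0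

theorem iter_congr (A : StochCA) (t : ℕ) (c c' : ℤ → A.Q) (s s' : Fin t → ℤ → A.R) (z z' : ℤ)
    (hc : ∀ v ∈ A.iterV t, c (z + v) = c' (z' + v))
    (hs : ∀ v ∈ A.iterV' t, ∀ j, s j (z + v) = s' j (z' + v)) :
    A.iter t c s z = A.iter t c' s' z' := by
  induction t generalizing z z' with
  | zero => simpa [iter, iterV] using hc
  | succ t ih =>
    simp only [iter, global]
    congr 1
    · funext v
      refine ih _ _ _ _ (fun w hw => ?_) (fun w hw j => ?_)
      · simpa only [add_assoc] using hc _ (Finset.add_mem_add v.2 hw)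
      · simpa only [add_assoc] using
          hs _ (Finset.mem_union_right _ (Finset.add_mem_add v.2 hw)) j.castSucc
    · funext v
      exact hs _ (Finset.mem_union_left _ v.2) _

theorem global_rescale (A : StochCA) (m t : ℕ) [NeZero m] (k : ℤ) (c : ℤ → Fin m → A.Q)
    (s : ℤ → Fin t → Fin m → A.R) :
    (A.rescale m t k).global c s = A.rescaleGlobal m t k c s := by
  have hm : (m : ℤ) ≠ 0 := by exact_mod_cast NeZero.ne m
  funext z j
  change A.rescaleGlobal m t k (extend _) (extend _) 0 j = _
  simp only [rescaleGlobal, pack, shift]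
  have hd : ∀ v : ℤ, ((m : ℤ) * z + (j : ℕ) + k + v) / m = z + ((j : ℕ) + k + v) / m := by
    intro v
    rw [add_assoc, add_assoc, Int.mul_add_ediv_left _ _ hm, ← add_assoc]
  have he : ∀ v : ℤ, ((m : ℤ) * z + (j : ℕ) + k + v) % m = ((j : ℕ) + k + v) % m := by
    intro v
    rw [add_assoc, add_assoc, Int.mul_add_emod_self_left, ← add_assoc]
  have hmem : ∀ (N : Finset ℤ) (v : ℤ), v ∈ N → (((j : ℕ) : ℤ) + k + v) / m ∈ blockNbhd m k N :=
    fun N v hv => Finset.mem_image.2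
      ⟨((j : ℕ), v), Finset.mem_product.2 ⟨Finset.mem_range.2 j.2, hv⟩, rfl⟩
  refine A.iter_congr t _ _ _ _ _ _ (fun v hv => ?_) (fun v hv l => ?_)
  · simp only [unpack, mul_zero, zero_add, hd, he, extend]
    rw [dif_pos (hmem _ v hv)]
  · simp only [unpack, mul_zero, zero_add, hd, he, extend]
    rw [dif_pos (hmem _ v hv)]

/-! ### Simulation pre-orders -/

/-- The stochastic injective simulation pre-order: `A₂` simulates `A₁`. -/
def SimInj (A₁ A₂ : StochCA) : Prop :=
  ∃ (m₁ m₂ t₁ t₂ : ℕ+) (k₁ k₂ : ℤ), StochSub (A₁.rescale m₁ t₁ k₁) (A₂.rescale m₂ t₂ k₂)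

/-- The stochastic mixed simulation pre-order: `A₂` simulates `A₁`. -/
def SimMix (A₁ A₂ : StochCA) : Prop :=
  ∃ (m₁ m₂ t₁ t₂ : ℕ+) (k₁ k₂ : ℤ), StochMix (A₁.rescale m₁ t₁ k₁) (A₂.rescale m₂ t₂ k₂)

end StochCA

end

/-! Universality. A state of the universal automaton holds one instruction taken from a finite set
depending only on `R`, and data drift left, one cell per step, over these fixed instructions. An
arbitrary local rule must therefore be spelled out in space: a program block of `m` cells meets a
word of three consecutive data blocks, and each of its heads alters at most one letter, the one
bearing a flag. One pass samples fresh random symbols into the first block; then there is one pass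
per entry of the rule's table, which compares the first two blocks with that entry and, if they
agree, overwrites the third with the result.

Every data block meets three program blocks in turn, as first, second and third block of their
words. It is thus sampled once, read by two rule evaluations together with the same stored symbols,
and finally recycled to hold an output. This sharing of symbols reproduces the correlations between
neighboring cells, although the universal automaton is plain (`word_rule`, `iter_rule`). After `4 *
m` steps all heads are idle again.

Randomness must be decoded exactly, not approximately: uniform symbols of the simulated alphabet
come from words over `R` by a balanced map, which needs only that the target size divide a power of
`|R|`. With `|R| = ∏ p ∈ P, p`, this is the condition on prime factors. Grouping and translating
cells first reduces to rules reading only a cell and its right neighbor.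

Optimality. One-cell events of an automaton have probability `k / |R| ^ n`. Rescaling replaces `|R|`
by a power, and trimming leaves it unchanged, so the probability `1 / p` forces `p` to divide `|R|`.
-/

/-! ### Balanced maps and uniform laws -/

/-- A map is balanced if it is the first projection of a product, up to a bijection. -/
def IsBalanced {X Y : Type*} (g : X → Y) : Prop :=
  ∃ (K : Type) (e : X ≃ Y × K), ∀ x, (e x).1 = g x

namespace IsBalanced

theorem comp {X Y Z : Type*} {g : Y → Z} {h : X → Y} (hg : IsBalanced g) (hh : IsBalanced h) :
    IsBalanced (g ∘ h) := by
  obtain ⟨K, e, he⟩ := hg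
  obtain ⟨K', e', he'⟩ := hh
  refine ⟨K × K', e'.trans ((e.prodCongr (Equiv.refl K')).trans (Equiv.prodAssoc _ _ _)), ?_⟩
  intro x
  simp [he, he']

/-- The complementary factor consists of the coordinates outside the range of `j`. -/
theorem precomp {ι κ R : Type} {j : ι → κ} (hj : Function.Injective j) :
    IsBalanced fun s : κ → R => s ∘ j := by
  classical
  refine ⟨{k // k ∉ Set.range j} → R,
    (Equiv.piEquivPiSubtypeProd (fun k => k ∈ Set.range j) fun _ => R).trans
      (((Equiv.ofInjective j hj).symm.arrowCongr (Equiv.refl R)).prodCongr (Equiv.refl _)), ?_⟩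
  intro s
  funext x
  simp [Equiv.piEquivPiSubtypeProd, Equiv.arrowCongr]

theorem exists_of_dvd {X Y : Type} [Finite X] [Finite Y] [Nonempty X]
    (h : Nat.card Y ∣ Nat.card X) : ∃ g : X → Y, IsBalanced g := by
  obtain ⟨k, hk⟩ := h
  have e : X ≃ Y × Fin k := Nonempty.some <| by
    rw [← Finite.card_eq]
    simp [hk]
  exact ⟨fun x => (e x).1, Fin k, e, fun _ => rfl⟩

/-- All fibers have the size of the complementary factor `K`, so counting measures match after
normalization. -/
theorem map_uniformOn {X Y : Type*} [Finite X] [Finite Y] [Nonempty X] [MeasurableSpace X]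
    [DiscreteMeasurableSpace X] [MeasurableSpace Y] [DiscreteMeasurableSpace Y] {g : X → Y}
    (hg : IsBalanced g) :
    (ProbabilityTheory.uniformOn (Set.univ : Set X)).map g =
      ProbabilityTheory.uniformOn (Set.univ : Set Y) := by
  classical
  obtain ⟨K, e, he⟩ := hg
  cases nonempty_fintype X
  cases nonempty_fintype Y
  have hY : Nonempty Y := ⟨g (Classical.arbitrary X)⟩
  have hXf : Finite (Y × K) := Finite.of_equiv X e
  have hK : Finite K := Finite.of_surjective (fun y : Y × K => y.2)
    fun k => ⟨(Classical.arbitrary Y, k), rfl⟩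
  cases nonempty_fintype K
  have hKn : Nonempty K := ⟨(e (Classical.arbitrary X)).2⟩
  have hK0 : (Fintype.card K : ENNReal) ≠ 0 := by simp
  refine Measure.ext_of_singleton fun y => ?_
  rw [Measure.map_apply (measurable_of_finite g) (measurableSet_singleton y),
    ProbabilityTheory.uniformOn_univ, ProbabilityTheory.uniformOn_univ, Measure.count_singleton,
    Measure.count_apply (Set.toFinite _).measurableSet]
  have hc : Fintype.card X = Fintype.card Y * Fintype.card K := by
    rw [Fintype.card_congr e, Fintype.card_prod]
  have hf : (g ⁻¹' {y}).encard = Fintype.card K := by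
    have h1 : g ⁻¹' {y} = e ⁻¹' (Set.range fun k : K => (y, k)) := by
      ext x
      simp only [Set.mem_preimage, Set.mem_singleton_iff, ← he, Set.mem_range]
      constructor
      · rintro rfl
        exact ⟨(e x).2, rfl⟩
      · rintro ⟨k, hk⟩
        rw [← hk]
    rw [h1, Set.encard_preimage_of_bijective e.bijective,
      ← Set.image_univ, Function.Injective.encard_image (fun a b h => by simpa using h),
      Set.encard_univ, ENat.card_eq_coe_fintype_card]
  rw [hf, hc]
  push_cast
  rw [mul_comm, ENNReal.div_eq_inv_mul, ENNReal.div_eq_inv_mul,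
    ENNReal.mul_inv (by simp) (by simp), mul_comm, ← mul_assoc,
    ENNReal.mul_inv_cancel hK0 (by simp), one_mul, mul_one]

end IsBalanced

/-! ### Laws of random configurations and of their images -/

namespace StochCA

theorem randomSource_cylinder (A : StochCA) (N : Finset ℤ) (x : ℤ → A.R) :
    A.randomSource {s | ∀ z ∈ N, s z = x z} = ((Nat.card A.R : ENNReal)⁻¹) ^ N.card := by
  classical
  cases nonempty_fintype A.R
  have h : {s : ℤ → A.R | ∀ z ∈ N, s z = x z} = Set.pi N fun z => {x z} := by
    ext s
    simp
  rw [h, randomSource, Measure.infinitePi_pi _ (fun i _ => measurableSet_singleton (x i))]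
  simp [ProbabilityTheory.uniformOn_univ]

/-- A product measure is determined by finite boxes; translating only reindexes a box, and each side
of it is handled by `IsBalanced.map_uniformOn`. -/
theorem map_randomSource {A B : StochCA} {g : A.R → B.R} (hg : IsBalanced g) (δ : ℤ) :
    A.randomSource.map (fun s z => g (s (z + δ))) = B.randomSource := by
  classical
  have hm : Measurable fun (s : ℤ → A.R) (z : ℤ) => g (s (z + δ)) :=
    measurable_pi_lambda _ fun z => (measurable_of_finite g).comp (measurable_pi_apply _)
  refine Measure.eq_infinitePi _ fun S t ht => ?_
  rw [Measure.map_apply hm (.pi S.countable_toSet fun _ _ => ht _)]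
  have h : (fun (s : ℤ → A.R) (z : ℤ) => g (s (z + δ))) ⁻¹' (S : Set ℤ).pi t =
      Set.pi ((S.map (Equiv.addRight δ).toEmbedding : Finset ℤ) : Set ℤ)
        fun z => g ⁻¹' t (z - δ) := by
    ext s
    simp [sub_eq_add_neg,
      (Equiv.addRight δ).forall_congr_left (p := fun i => i ∈ S → g (s (i + δ)) ∈ t i)]
  rw [h, randomSource, Measure.infinitePi_pi _ (fun i _ => measurable_of_finite g (ht _)),
    Finset.prod_map]
  refine Finset.prod_congr rfl fun z _ => ?_
  rw [← hg.map_uniformOn, Measure.map_apply (measurable_of_finite g) (ht z)]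
  simp

/-- Probabilities of events on one cell have a denominator dividing a power of the size of the
random alphabet. -/
theorem exists_stochGlobal_eq (C : StochCA) (c : ℤ → C.Q) (z : ℤ) (E : Set C.Q) :
    ∃ k n : ℕ, C.stochGlobal c {d | d z ∈ E} = k * ((Nat.card C.R : ENNReal)⁻¹) ^ n := by
  classical
  cases nonempty_fintype C.R
  -- Only the symbols on `z + V'` matter, so the event is a disjoint union of cylinders over `N`,
  -- all of the same measure.
  let N : Finset ℤ := C.V'.map (Equiv.addLeft z).toEmbedding
  have hmem : ∀ v : C.V', z + v ∈ N := fun v => Finset.mem_map.2 ⟨v, v.2, rfl⟩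
  let G : (C.V' → C.R) → Prop := fun x => C.f (fun v => c (z + v)) x ∈ E
  let ext : (C.V' → C.R) → ℤ → C.R := fun x y => extend x (y - z)
  have hext : ∀ x (v : C.V'), ext x (z + v) = x v := by
    intro x v
    simp [ext, extend]
  let T : Finset (C.V' → C.R) := Finset.univ.filter G
  refine ⟨T.card, N.card, ?_⟩
  have hE : MeasurableSet {d : ℤ → C.Q | d z ∈ E} :=
    measurable_pi_apply (X := fun _ : ℤ => C.Q) z (MeasurableSet.of_discrete (s := E))
  rw [stochGlobal, Measure.map_apply (C.measurable_global c) hE]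
  have hcyl : ∀ x : C.V' → C.R, ∀ s : ℤ → C.R,
      (∀ y ∈ N, s y = ext x y) ↔ x = fun v : C.V' => s (z + v) := by
    intro x s
    constructor
    · intro h
      funext v
      rw [h _ (hmem v), hext]
    · rintro rfl y hy
      obtain ⟨v, hv, rfl⟩ := Finset.mem_map.1 hy
      exact (hext (fun v => s (z + v)) ⟨v, hv⟩).symm
  have hun : C.global c ⁻¹' {d | d z ∈ E} = ⋃ x ∈ T, {s | ∀ y ∈ N, s y = ext x y} := by
    ext s
    simp only [Set.mem_preimage, Set.mem_ofPred_eq, Set.mem_iUnion, hcyl, exists_prop,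
      exists_eq_right]
    simp [T, G, global]
  rw [hun, measure_biUnion_finset]
  · simp only [randomSource_cylinder, Finset.sum_const, nsmul_eq_mul]
  · intro x _ x' _ hxx
    refine Set.disjoint_left.2 fun s hs hs' => hxx ?_
    rw [(hcyl x s).1 hs, (hcyl x' s).1 hs']
  · intro x _
    have : {s : ℤ → C.R | ∀ y ∈ N, s y = ext x y} = Set.pi N fun y => {ext x y} := by
      ext s
      simp
    rw [this]
    exact .pi N.countable_toSet fun _ _ => measurableSet_singleton _

/-! ### Relations between the simulation pre-orders -/

/-- Project by the identity. -/
theorem StochSub.stochMix {A B : StochCA} (h : StochSub A B) : StochMix A B := by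
  obtain ⟨i, hi, he⟩ := h
  refine ⟨A.Q, inferInstance, inferInstance, i, id, hi, ⟨Function.surjective_id, ?_⟩, ?_⟩
  · intro s c c' hc z
    obtain rfl : c = c' := funext hc
    rfl
  · rw [he]
    funext c
    have hid : Function.invFun (id : A.Q → A.Q) = id :=
      Function.LeftInverse.id (Function.leftInverse_invFun Function.injective_id)
    simp only [stochGlobal]
    congr 1
    funext s z
    change _ = Function.invFun i (B.f (fun v => i (Function.invFun id (c (z + v)))) _)
    rw [hid]
    rfl

theorem SimInj.simMix {A B : StochCA} (h : A.SimInj B) : A.SimMix B := by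
  obtain ⟨m₁, m₂, t₁, t₂, k₁, k₂, h⟩ := h
  exact ⟨m₁, m₂, t₁, t₂, k₁, k₂, h.stochMix⟩

/-- Exact simulation with random symbols decoded by a balanced map. -/
theorem stochSub_of_global_eq {B C : StochCA} (i : B.Q → C.Q) (hi : Function.Injective i)
    {g : C.R → B.R} (hg : IsBalanced g) (δ : ℤ)
    (h : ∀ c s z, C.global (fun z => i (c z)) s z = i (B.global c (fun z => g (s (z + δ))) z)) :
    StochSub B C := by
  have hr : C.CanRestrict i := by
    refine ⟨hi, fun c s hc z => ?_⟩
    choose c' hc' using hc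
    obtain rfl : (fun z => i (c' z)) = c := funext hc'
    exact ⟨_, (h c' s z).symm⟩
  refine ⟨i, hr, ?_⟩
  funext c
  have hm : Measurable fun (s : ℤ → C.R) (z : ℤ) => g (s (z + δ)) :=
    measurable_pi_lambda _ fun z => (measurable_of_finite g).comp (measurable_pi_apply _)
  have he : (C.restrict i).global c = B.global c ∘ fun s z => g (s (z + δ)) := by
    funext s z
    apply hi
    rw [Function.comp_apply, ← h c s z]
    exact congrFun (C.global_restrict i hr c s) z
  have h2 : (C.restrict i).stochGlobal c = C.randomSource.map ((C.restrict i).global c) := rfl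
  rw [h2, he, stochGlobal, ← map_randomSource hg δ, Measure.map_map (B.measurable_global c) hm]
  rfl

/-! ### Optimality -/

/-- Each cell becomes uniform on `Fin p`, independently of everything else. -/
def noise (p : ℕ) [NeZero p] : StochCA where
  Q := Fin p
  R := Fin p
  V := ∅
  V' := {0}
  f := fun _ s => s ⟨0, by simp⟩

theorem noise_global (p : ℕ) [NeZero p] (c : ℤ → (noise p).Q) (s : ℤ → (noise p).R) :
    (noise p).global c s = s := by
  funext z
  simp only [global, noise, add_zero]
  rfl

theorem noise_PF {p : ℕ} [NeZero p] (hp : p.Prime) : (noise p).PF = {p} := by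
  simp [PF, noise, hp.primeFactors]

/-- The value of a cell of a rescaling of `noise p` is uniform. -/
theorem noise_rescale_stochGlobal (p m t : ℕ) [NeZero p] [NeZero m] (ht : 0 < t) (k : ℤ)
    (c : ℤ → ((noise p).rescale m t k).Q) :
    ∃ E : Set ((noise p).rescale m t k).Q,
      ((noise p).rescale m t k).stochGlobal c {d | d 0 ∈ E} = (p : ENNReal)⁻¹ := by
  obtain ⟨t, rfl⟩ : ∃ t', t = t' + 1 := ⟨t - 1, by omega⟩
  let B := (noise p).rescale m (t + 1) k
  change ∃ E : Set B.Q, B.stochGlobal c {d | d 0 ∈ E} = (p : ENNReal)⁻¹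
  -- The last step erases the past, so only the last random layer counts. After the translation,
  -- cell `0` reads position `k`: entry `k % m` of block `k / m`.
  let l : Fin m := ⟨((0 + k) % (m : ℤ)).toNat, by
    have hm : (0 : ℤ) < (m : ℤ) := by exact_mod_cast Nat.pos_of_neZero m
    have h1 := Int.emod_nonneg (0 + k) hm.ne'
    have h2 := Int.emod_lt_of_pos (0 + k) hm
    omega⟩
  let g : B.R → (noise p).R := fun x => x (Fin.last t) l
  have hg : IsBalanced g := by
    have h1 : IsBalanced fun x : B.R => (x ∘ fun _ : Unit => Fin.last t) :=
      IsBalanced.precomp (fun _ _ _ => rfl)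
    have h2 : IsBalanced fun x : Fin m → Fin p => (x ∘ fun _ : Unit => l) :=
      IsBalanced.precomp (fun _ _ _ => rfl)
    have h3 : ∀ X : Type, IsBalanced fun x : Unit → X => x () :=
      fun X => ⟨Unit, (Equiv.funUnique Unit X).trans (Equiv.prodPUnit X).symm, fun _ => rfl⟩
    exact ((h3 _).comp h2).comp ((h3 _).comp h1)
  refine ⟨{q | q ⟨0, Nat.pos_of_neZero m⟩ = (0 : Fin p)}, ?_⟩
  have hv : ∀ s, B.global c s 0 ⟨0, Nat.pos_of_neZero m⟩ = g (s (0 + k / (m : ℤ))) := by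
    intro s
    refine (congrFun (congrFun ((noise p).global_rescale m (t + 1) k c s) 0) _).trans ?_
    simp only [rescaleGlobal, pack, shift, iter]
    refine (congrFun (noise_global p _ _) _).trans ?_
    simp only [unpack, g, l, mul_zero, Nat.cast_zero, zero_add]
    rfl
  have hE : MeasurableSet
      {d : ℤ → B.Q | d 0 ∈ {q : B.Q | q ⟨0, Nat.pos_of_neZero m⟩ = (0 : Fin p)}} :=
    measurable_pi_apply (X := fun _ : ℤ => B.Q) 0 (MeasurableSet.of_discrete)
  refine (Measure.map_apply (B.measurable_global c) hE).trans ?_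
  have hpre : B.global c ⁻¹'
        {d : ℤ → B.Q | d 0 ∈ {q : B.Q | q ⟨0, Nat.pos_of_neZero m⟩ = (0 : Fin p)}} =
      (fun (s : ℤ → B.R) (z : ℤ) => g (s (z + k / (m : ℤ)))) ⁻¹'
        {s | ∀ z ∈ ({0} : Finset ℤ), s z = (0 : Fin p)} := by
    ext s
    simp only [Set.mem_preimage, Set.mem_ofPred_eq, hv, Finset.mem_singleton, forall_eq]
    rfl
  have hm : Measurable fun (s : ℤ → B.R) (z : ℤ) => g (s (z + k / (m : ℤ))) :=
    measurable_pi_lambda _ fun z => (measurable_of_finite g).comp (measurable_pi_apply _)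
  have hS : MeasurableSet {s : ℤ → (noise p).R | ∀ z ∈ ({0} : Finset ℤ), s z = (0 : Fin p)} := by
    simp only [Finset.mem_singleton, forall_eq]
    exact measurable_pi_apply (X := fun _ : ℤ => (noise p).R) 0
      (MeasurableSet.of_discrete (s := {x : (noise p).R | x = (0 : Fin p)}))
  rw [hpre, ← Measure.map_apply hm hS, map_randomSource hg,
    randomSource_cylinder (noise p) {0} fun _ => (0 : Fin p)]
  simp [noise]

/-- Comparing `1 / p` with `k / r ^ n`, where `r` is a power of `|U.R|`, gives `k * p = r ^ n`,
hence `p ∣ |U.R|`. -/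
theorem not_simMix_noise {p : ℕ} [NeZero p] (hp : p.Prime) (U : StochCA) (hU : p ∉ U.PF) :
    ¬ (noise p).SimMix U := by
  rintro ⟨m₁, m₂, t₁, t₂, k₁, k₂, Q', _, _, i, π, -, -, h⟩
  have c : ℤ → ((noise p).rescale m₁ t₁ k₁).Q := Classical.arbitrary _
  obtain ⟨E, hE⟩ := noise_rescale_stochGlobal p m₁ t₁ t₁.pos k₁ c
  rw [h] at hE
  obtain ⟨k, n, hk⟩ := exists_stochGlobal_eq
    (((U.rescale m₂ t₂ k₂).restrict i).project (Q' := ((noise p).rescale m₁ t₁ k₁).Q) π) c 0 E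
  replace hE := hk.symm.trans hE
  set r := Nat.card (((U.rescale m₂ t₂ k₂).restrict i).project
    (Q' := ((noise p).rescale m₁ t₁ k₁).Q) π).R with hr
  have hr' : r = (Nat.card U.R ^ (m₂ : ℕ)) ^ (t₂ : ℕ) := by
    change Nat.card (Fin t₂ → Fin m₂ → U.R) = _
    simp [Nat.card_fun]
  have hr0 : r ≠ 0 := by
    rw [hr']
    have : Nat.card U.R ≠ 0 := Nat.card_pos.ne'
    positivity
  have h1 : (k * p : ENNReal) = (r : ENNReal) ^ n := by
    have hr1 : (r : ENNReal) ^ n ≠ 0 := by simp [hr0]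
    have hr2 : (r : ENNReal) ^ n ≠ ⊤ := by simp
    have hp0 : (p : ENNReal) ≠ 0 := by simp [hp.ne_zero]
    calc (k * p : ENNReal) = k * p * (((r : ENNReal) ^ n)⁻¹ * (r : ENNReal) ^ n) := by
          rw [ENNReal.inv_mul_cancel hr1 hr2, mul_one]
      _ = (k * ((r : ENNReal)⁻¹) ^ n) * p * (r : ENNReal) ^ n := by
          rw [ENNReal.inv_pow]; ring
      _ = (r : ENNReal) ^ n := by
          rw [hE, ENNReal.inv_mul_cancel hp0 (by simp), one_mul]
  have h2 : k * p = r ^ n := by exact_mod_cast h1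
  have h3 : p ∣ Nat.card U.R := by
    have h4 : p ∣ r ^ n := ⟨k, by rw [← h2, mul_comm]⟩
    rw [hr'] at h4
    exact hp.dvd_of_dvd_pow (hp.dvd_of_dvd_pow (hp.dvd_of_dvd_pow h4))
  exact hU (Nat.mem_primeFactors.2 ⟨hp, h3, Nat.card_pos.ne'⟩)

end StochCA

namespace StochCA

/-! ### The universal automaton

The data move to the left, by one cell per step, over a static program. Each cell of the program
is a head, which sweeps the data from left to right. A head is active during three consecutive data
blocks, the phases `0`, `1`, `2`; in phase `3` it is idle. Letters are processed one at a time: a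
flag holding a Boolean walks over the data, one letter to the right under each head. -/

section Machine

variable (R : Type)

/-- A letter holds a bit and a random symbol. -/
abbrev Letter := Bool × R

/-- What a head does to a flagged letter: it updates the flag and the letter. -/
abbrev Walk := Bool → Letter R → R → Bool × Letter R

/-- Instructions: `none` puts a flag on the first letter, `some γ` applies `γ` to the flagged
letter and moves the flag to the next letter. -/
abbrev Op := Option (Walk R)

/-- A letter together with its flag, if any. -/
abbrev Cell := Option Bool × Letter R

variable {R}

/-- Action of an active head, carrying a flag or not, on a letter. -/
def headStep (o : Op R) (first : Prop) [Decidable first] (k : Option Bool) (x : Cell R) (s : R) :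
    Option Bool × Cell R :=
  match o, x.1 with
  | none, _ => (none, (if first then some true else none, x.2))
  | some _, none => (none, (k, x.2))
  | some γ, some φ => (some (γ φ x.2 s).1, (k, (γ φ x.2 s).2))

/-- New state of a cell with instruction `o` and head state `h` when the data `d` arrive: the phase
advances at the marks, blank data are skipped. -/
def cellStep (o : Op R) (h : Fin 4 × Option Bool) (d : Bool × Option (Cell R)) (s : R) :
    Op R × (Fin 4 × Option Bool) × (Bool × Option (Cell R)) :=
  let ph := if d.1 then h.1 + 1 else h.1
  if ph = 3 then (o, (3, none), d) else
    match d.2 with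
    | none => (o, (ph, h.2), d)
    | some x =>
      let r := headStep o (d.1 = true ∧ ph = 0) h.2 x s
      (o, (ph, r.1), (d.1, some r.2))

variable (R) in
/-- The universal automaton with random alphabet `R`. -/
def univCA [Finite R] [Nonempty R] : StochCA where
  Q := Op R × (Fin 4 × Option Bool) × (Bool × Option (Cell R))
  R := R
  V := {0, 1}
  V' := {0}
  f := fun c s => cellStep (c ⟨0, by simp⟩).1 (c ⟨0, by simp⟩).2.1 (c ⟨1, by simp⟩).2.2
    (s ⟨0, by simp⟩)

theorem univCA_global [Finite R] [Nonempty R] (c : ℤ → (univCA R).Q) (s : ℤ → R) (x : ℤ) :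
    (univCA R).global c s x = cellStep (c x).1 (c x).2.1 (c (x + 1)).2.2 (s x) := by
  simp only [global, univCA, add_zero]

/-- The flag carried by a head before it reaches the letter `n` of the word `w`. -/
def carry (o : Op R) (w : ℕ → Cell R) (s : ℕ → R) : ℕ → Option Bool
  | 0 => none
  | n + 1 => (headStep o (n = 0) (carry o w s n) (w n) (s n)).1

/-- The word `w` after the passage of a head. -/
def sweep (o : Op R) (w : ℕ → Cell R) (s : ℕ → R) (n : ℕ) : Cell R :=
  (headStep o (n = 0) (carry o w s n) (w n) (s n)).2

/-- Random symbol met by the head `i` of the program block `b` on its letter `n`. -/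
def symbolAt (m L : ℕ) (S : ℕ → ℤ → R) (b : ℤ) (i n : ℕ) : R :=
  S (n / L * m + n % L + i) (b * m + (m - 1 - i : ℕ))

/-- The words met by the successive heads of the program block `b`. -/
def word (m L : ℕ) (op : ℕ → Op R) (S : ℕ → ℤ → R) (w₀ : ℤ → ℕ → Cell R) (b : ℤ) :
    ℕ → ℕ → Cell R
  | 0 => w₀ b
  | i + 1 => sweep (op i) (word m L op S w₀ b i) (symbolAt m L S b i)

/-! ### The predicted space-time diagram of a run -/

section Schedule

variable (m L : ℕ) (op : ℕ → Op R) (S : ℕ → ℤ → R) (w₀ d₀ d₁ : ℤ → ℕ → Cell R)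

/-- The letter `j` of the data block `β` when it meets the head `i` of the program block `b`. -/
def letterAt (b : ℤ) (i : ℕ) (β : ℤ) (j : ℕ) : Cell R :=
  if β ≤ b then d₀ β j
  else if β ≤ b + 3 then word m L op S w₀ b i ((β - b - 1).toNat * L + j)
  else d₁ β j

/-- The data at position `j` of the data block `β` when they meet the head `i` of the program
block `b`. -/
def dataAt (b : ℤ) (i : ℕ) (β : ℤ) (j : ℕ) : Bool × Option (Cell R) :=
  (decide (j = 0), if j < L then some (letterAt m L op S w₀ d₀ d₁ b i β j) else none)

/-- State of the head `i` of the program block `b` after the position `j` of the data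
block `β`. -/
def headAfter (b : ℤ) (i : ℕ) (β : ℤ) (j : ℕ) : Fin 4 × Option Bool :=
  if β = b + 1 then
    (0, carry (op i) (word m L op S w₀ b i) (symbolAt m L S b i) (min (j + 1) L))
  else if β = b + 2 then
    (1, carry (op i) (word m L op S w₀ b i) (symbolAt m L S b i) (L + min (j + 1) L))
  else if β = b + 3 then
    (2, carry (op i) (word m L op S w₀ b i) (symbolAt m L S b i) (2 * L + min (j + 1) L))
  else (3, none)

/-- State of the head `i` of the program block `b` before the position `j` of the data
block `β`. -/
def headBefore (b : ℤ) (i : ℕ) (β : ℤ) (j : ℕ) : Fin 4 × Option Bool :=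
  if j = 0 then headAfter m L op S w₀ b i (β - 1) (m - 1)
  else headAfter m L op S w₀ b i β (j - 1)

variable {m L op S w₀ d₀ d₁}

/-- Here `κ` is the rank of the data block within the word of the head. Past its `L` letters the
block is blank and the carried flag waits, whence `min j L`; it survives the marks, so the three
blocks behave as one word of `3 * L` letters. -/
theorem cellStep_active {o : Op R} {w : ℕ → Cell R} {σ : ℕ → R} {κ j : ℕ}
    {h : Fin 4 × Option Bool} {ph : Fin 4} {s : R} (hph : (if j = 0 then h.1 + 1 else h.1) = ph)
    (h3 : ph ≠ 3) (h0 : ph = 0 ↔ κ = 0) (hL : 0 < L)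
    (hk : h.2 = carry o w σ (κ * L + min j L)) (hs : j < L → s = σ (κ * L + j)) :
    cellStep o h (decide (j = 0), if j < L then some (w (κ * L + j)) else none) s =
      (o, (ph, carry o w σ (κ * L + min (j + 1) L)),
        (decide (j = 0), if j < L then some (sweep o w σ (κ * L + j)) else none)) := by
  have hf : (j = 0 ∧ ph = 0) ↔ κ * L + j = 0 := by
    rw [h0]
    simp [hL.ne', and_comm]
  by_cases hj : j < L
  · have e1 : min j L = j := by omega
    have e2 : min (j + 1) L = j + 1 := by omega
    rw [e1] at hk
    simp only [cellStep, decide_eq_true_eq, hph, h3, if_false, hj, if_true, e2, hf, hk, hs hj]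
    rfl
  · have e1 : min j L = L := by omega
    have e2 : min (j + 1) L = L := by omega
    rw [e1] at hk
    simp only [cellStep, decide_eq_true_eq, hph, h3, if_false, hj, e2, hk]

/-- A head stays idle over the rest of its own block, works over the next three, and drops any
remaining flag at the fourth mark. The mark of its own block is excluded by `h₃`, since it would
start the head too early. -/
theorem cellStep_schedule (hL : 0 < L) (hm : L ≤ m) {b β : ℤ} {i j : ℕ}
    (h₁ : b ≤ β) (h₂ : β ≤ b + 4) (h₃ : β = b → 0 < j) (s : R)
    (hs : ∀ κ : ℕ, κ < 3 → β = b + 1 + κ → j < L → s = symbolAt m L S b i (κ * L + j)) :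
    cellStep (op i) (headBefore m L op S w₀ b i β j) (dataAt m L op S w₀ d₀ d₁ b i β j) s =
      (op i, headAfter m L op S w₀ b i β j, dataAt m L op S w₀ d₀ d₁ b (i + 1) β j) := by
  have hlet : ∀ κ : ℕ, κ < 3 → β = b + 1 + κ → ∀ i,
      letterAt m L op S w₀ d₀ d₁ b i β j = word m L op S w₀ b i (κ * L + j) := by
    intro κ hκ hβ i
    rw [letterAt, if_neg (by omega), if_pos (by omega)]
    congr
    omega
  have hmin : min (m - 1 + 1) L = L := by omega
  have hcases : β = b ∨ β = b + 4 ∨ ∃ κ : ℕ, κ < 3 ∧ β = b + 1 + κ := by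
    rcases eq_or_ne β b with h | h
    · exact Or.inl h
    rcases eq_or_ne β (b + 4) with h' | h'
    · exact Or.inr (Or.inl h')
    exact Or.inr (Or.inr ⟨(β - b - 1).toNat, by omega, by omega⟩)
  rcases hcases with h | h | h
  · have h0 : j ≠ 0 := (h₃ h).ne'
    subst h
    simp [cellStep, headBefore, headAfter, dataAt, letterAt, h0]
  · subst h
    by_cases h0 : j = 0
    · subst h0
      have e1 : b + 4 - 1 = b + 3 := by ring
      simp [cellStep, headBefore, headAfter, dataAt, letterAt, e1]
    · simp [cellStep, headBefore, headAfter, dataAt, letterAt, h0]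
  · obtain ⟨κ, hκ, rfl⟩ := h
    simp only [dataAt, hlet κ hκ rfl]
    have hA : ∀ j, headAfter m L op S w₀ b i (b + 1 + κ) j =
        (Fin.ofNat 4 κ, carry (op i) (word m L op S w₀ b i) (symbolAt m L S b i)
          (κ * L + min (j + 1) L)) := by
      intro j
      interval_cases κ <;> simp [headAfter, add_assoc]
      rfl
    rw [hA, show word m L op S w₀ b (i + 1) = sweep (op i) (word m L op S w₀ b i)
      (symbolAt m L S b i) from rfl]
    have h3 : Fin.ofNat 4 κ ≠ 3 := by interval_cases κ <;> decide
    have h0 : Fin.ofNat 4 κ = 0 ↔ κ = 0 := by interval_cases κ <;> decide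
    by_cases hj : j = 0
    · subst hj
      refine cellStep_active ?_ h3 h0 hL ?_ (hs κ hκ rfl)
      · rw [headBefore, if_pos rfl, if_pos rfl]
        interval_cases κ
        · simp [headAfter]
        · simp [headAfter]
          rfl
        · have e1 : b + 1 + (2 : ℕ) - 1 = b + 2 := by push_cast; ring
          rw [e1]
          simp [headAfter]
      · rw [headBefore, if_pos rfl]
        interval_cases κ
        · simp [headAfter, carry]
        · simp [headAfter, hmin]
        · have e1 : b + 1 + (2 : ℕ) - 1 = b + 2 := by push_cast; ring
          rw [e1]
          simp [headAfter, hmin, two_mul]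
    · refine cellStep_active ?_ h3 h0 hL ?_ (hs κ hκ rfl)
      · rw [headBefore, if_neg hj, if_neg hj, hA]
      · rw [headBefore, if_neg hj, hA, Nat.sub_add_cancel (by omega)]

theorem headBefore_succ (hm : 0 < m) (b : ℤ) (i : ℕ) (y : ℤ) :
    headBefore m L op S w₀ b i ((y + 1) / m) ((y + 1) % m).toNat =
      headAfter m L op S w₀ b i (y / m) (y % m).toNat := by
  have hm' : (0 : ℤ) < m := by exact_mod_cast hm
  have h0 := Int.emod_nonneg y hm'.ne'
  have h1 := Int.emod_lt_of_pos y hm'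
  have h2 := Int.mul_ediv_add_emod y m
  by_cases h : y % m = m - 1
  · have e : y + 1 = (y / m + 1) * m := by linarith
    have e1 : (y + 1) / m = y / m + 1 := by rw [e]; exact Int.mul_ediv_cancel _ hm'.ne'
    have e2 : (y + 1) % m = 0 := by rw [e]; exact Int.mul_emod_left _ _
    rw [headBefore, e1, e2, Int.toNat_zero, if_pos rfl, h, add_sub_cancel_right]
    congr
    omega
  · have e : y + 1 = y % m + 1 + m * (y / m) := by linarith
    have e1 : (y + 1) / m = y / m := by
      rw [e, Int.add_mul_ediv_left _ _ hm'.ne', Int.ediv_eq_zero_of_lt (by omega) (by omega),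
        zero_add]
    have e2 : (y + 1) % m = y % m + 1 := by
      rw [e, Int.add_mul_emod_self_left, Int.emod_eq_of_lt (by omega) (by omega)]
    rw [headBefore, e1, e2, if_neg (by omega)]
    congr
    omega

/-- What leaves the head at `x` is what the head at `x - 1` will meet. Inside a program block this
is the definition; at a boundary the ranks in the word increase by one, which is what `h₀`, `h₁`,
`h₂` express: raw data enter, partial results are handed over, final data leave. -/
theorem dataAt_pred (hm : 0 < m) (h₀ : ∀ b, ∀ j < L, w₀ b j = d₀ (b + 1) j)
    (h₁ : ∀ b, ∀ κ < 2, ∀ j < L,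
      word m L op S w₀ b m (κ * L + j) = w₀ (b - 1) ((κ + 1) * L + j))
    (h₂ : ∀ b, ∀ j < L, word m L op S w₀ b m (2 * L + j) = d₁ (b + 3) j)
    (x β : ℤ) (j : ℕ) :
    dataAt m L op S w₀ d₀ d₁ ((x - 1) / m) (m - 1 - ((x - 1) % m).toNat) β j =
      dataAt m L op S w₀ d₀ d₁ (x / m) (m - 1 - (x % m).toNat + 1) β j := by
  have hm' : (0 : ℤ) < m := by exact_mod_cast hm
  have h0 := Int.emod_nonneg x hm'.ne'
  have h1 := Int.emod_lt_of_pos x hm'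
  have h2 := Int.mul_ediv_add_emod x m
  by_cases h : x % m = 0
  · have e : x - 1 = (m - 1) + m * (x / m - 1) := by linarith
    have e1 : (x - 1) / m = x / m - 1 := by
      rw [e, Int.add_mul_ediv_left _ _ hm'.ne', Int.ediv_eq_zero_of_lt (by omega) (by omega),
        zero_add]
    have e2 : (x - 1) % m = m - 1 := by
      rw [e, Int.add_mul_emod_self_left, Int.emod_eq_of_lt (by omega) (by omega)]
    rw [e1, e2, h]
    have e3 : m - 1 - ((m : ℤ) - 1).toNat = 0 := by omega
    have e4 : m - 1 - Int.toNat 0 + 1 = m := by simp; omega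
    rw [e3, e4]
    generalize x / m = b
    simp only [dataAt]
    congr 1
    refine if_ctx_congr Iff.rfl (fun hj => congrArg some ?_) fun _ => rfl
    unfold letterAt
    rcases lt_trichotomy β b with hβ | hβ | hβ
    · rw [if_pos (by omega), if_pos (by omega)]
    · subst hβ
      rw [if_neg (by omega), if_pos (by omega), if_pos le_rfl]
      have e5 : (β - (β - 1) - 1).toNat * L + j = j := by simp
      rw [e5]
      change w₀ (β - 1) j = _
      rw [h₀ _ _ hj, sub_add_cancel]
    · by_cases h3 : β ≤ b + 2
      · rw [if_neg (by omega), if_pos (by omega), if_neg (by omega), if_pos (by omega),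
          h₁ _ _ (by omega) _ hj]
        have e5 : (β - (b - 1) - 1).toNat = (β - b - 1).toNat + 1 := by omega
        rw [e5]
        rfl
      · rw [if_neg (by omega), if_neg (by omega), if_neg (by omega)]
        by_cases h4 : β ≤ b + 3
        · obtain rfl : β = b + 3 := by omega
          have e5 : (b + 3 - b - 1).toNat = 2 := by omega
          rw [if_pos le_rfl, ← h₂ _ _ hj, e5]
        · rw [if_neg h4]
  · have e : x - 1 = (x % m - 1) + m * (x / m) := by linarith
    have e1 : (x - 1) / m = x / m := by
      rw [e, Int.add_mul_ediv_left _ _ hm'.ne', Int.ediv_eq_zero_of_lt (by omega) (by omega),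
        zero_add]
    have e2 : (x - 1) % m = x % m - 1 := by
      rw [e, Int.add_mul_emod_self_left, Int.emod_eq_of_lt (by omega) (by omega)]
    rw [e1, e2]
    congr
    omega

variable (m L op S w₀ d₀ d₁) in
/-- The configuration at time `τ`. -/
def configAt [Finite R] [Nonempty R] (τ : ℕ) (x : ℤ) : (univCA R).Q :=
  -- Data come from the right, so heads are numbered from right to left. The cell `x` stores data it
  -- has already treated, hence about to meet the head at `x - 1`; its own head awaits the data that
  -- started at `x + τ + 1`.
  (op (m - 1 - (x % m).toNat),
    headBefore m L op S w₀ (x / m) (m - 1 - (x % m).toNat) ((x + τ + 1) / m)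
      ((x + τ + 1) % m).toNat,
    dataAt m L op S w₀ d₀ d₁ ((x - 1) / m) (m - 1 - ((x - 1) % m).toNat) ((x + τ) / m)
      ((x + τ) % m).toNat)

theorem global_configAt [Finite R] [Nonempty R] (hL : 0 < L) (hm : L ≤ m)
    (h₀ : ∀ b, ∀ j < L, w₀ b j = d₀ (b + 1) j)
    (h₁ : ∀ b, ∀ κ < 2, ∀ j < L,
      word m L op S w₀ b m (κ * L + j) = w₀ (b - 1) ((κ + 1) * L + j))
    (h₂ : ∀ b, ∀ j < L, word m L op S w₀ b m (2 * L + j) = d₁ (b + 3) j)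
    (τ : ℕ) (hτ : τ < 4 * m) :
    (univCA R).global (configAt m L op S w₀ d₀ d₁ τ) (S τ) =
      configAt m L op S w₀ d₀ d₁ (τ + 1) := by
  funext x
  have hm0 : 0 < m := hL.trans_le hm
  have hm' : (0 : ℤ) < m := by exact_mod_cast hm0
  rw [univCA_global]
  have ex : x + 1 - 1 = x := by ring
  have ey : x + 1 + (τ : ℤ) = x + τ + 1 := by ring
  have ez : x + ((τ + 1 : ℕ) : ℤ) = x + τ + 1 := by push_cast; ring
  simp only [configAt, ex, ey, ez]
  rw [headBefore_succ hm0 _ _ (x + τ + 1), dataAt_pred hm0 h₀ h₁ h₂]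
  have hx0 := Int.emod_nonneg x hm'.ne'
  have hx1 := Int.emod_lt_of_pos x hm'
  have hx2 := Int.mul_ediv_add_emod x m
  set y := x + τ + 1 with hy
  have hy0 := Int.emod_nonneg y hm'.ne'
  have hy2 := Int.mul_ediv_add_emod y m
  refine cellStep_schedule hL hm ?_ ?_ ?_ _ ?_
  · exact Int.ediv_le_ediv hm' (by omega)
  · have : y / m ≤ (x + 4 * m) / m := Int.ediv_le_ediv hm' (by omega)
    rwa [Int.add_mul_ediv_right _ _ hm'.ne'] at this
  · intro h
    rw [h] at hy2
    omega
  -- With `x = b * m + m - 1 - i` and `x + τ + 1 = (b + 1 + κ) * m + j`, the time is `τ = κ * m + j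
  -- + i`, as in `symbolAt`.
  · intro κ _ hκ hj
    have e1 : (κ * L + (y % m).toNat) / L = κ := by
      rw [mul_comm, Nat.mul_add_div hL, Nat.div_eq_of_lt hj, add_zero]
    have e2 : (κ * L + (y % m).toNat) % L = (y % m).toNat := by
      rw [mul_comm, Nat.mul_add_mod, Nat.mod_eq_of_lt hj]
    rw [symbolAt, e1, e2]
    congr 1
    · zify
      rw [hκ] at hy2
      rw [Int.toNat_of_nonneg hy0]
      have e3 : ((m - 1 - (x % m).toNat : ℕ) : ℤ) = m - 1 - x % m := by omega
      rw [e3]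
      linarith
    · have e3 : ((m - 1 - (m - 1 - (x % m).toNat) : ℕ) : ℤ) = x % m := by omega
      rw [e3]
      linarith

theorem iter_configAt [Finite R] [Nonempty R] (hL : 0 < L) (hm : L ≤ m)
    (h₀ : ∀ b, ∀ j < L, w₀ b j = d₀ (b + 1) j)
    (h₁ : ∀ b, ∀ κ < 2, ∀ j < L,
      word m L op S w₀ b m (κ * L + j) = w₀ (b - 1) ((κ + 1) * L + j))
    (h₂ : ∀ b, ∀ j < L, word m L op S w₀ b m (2 * L + j) = d₁ (b + 3) j)
    (τ : ℕ) (hτ : τ ≤ 4 * m) :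
    (univCA R).iter τ (configAt m L op S w₀ d₀ d₁ 0) (fun l => S l) =
      configAt m L op S w₀ d₀ d₁ τ := by
  induction τ with
  | zero => rfl
  | succ τ ih =>
    rw [← global_configAt hL hm h₀ h₁ h₂ τ (by omega), ← ih (by omega)]
    rfl

variable (m L op) in
/-- Program at rest over the data `d`. -/
def restConfig [Finite R] [Nonempty R] (d : ℤ → ℕ → Cell R) (x : ℤ) : (univCA R).Q :=
  (op (m - 1 - (x % m).toNat), (3, none), decide ((x % m).toNat = 0),
    if (x % m).toNat < L then some (d (x / m) (x % m).toNat) else none)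

/-- One complete run of the program. -/
theorem iter_restConfig [Finite R] [Nonempty R] (hL : 0 < L) (hm : L ≤ m)
    (h₀ : ∀ b, ∀ j < L, w₀ b j = d₀ (b + 1) j)
    (h₁ : ∀ b, ∀ κ < 2, ∀ j < L,
      word m L op S w₀ b m (κ * L + j) = w₀ (b - 1) ((κ + 1) * L + j))
    (h₂ : ∀ b, ∀ j < L, word m L op S w₀ b m (2 * L + j) = d₁ (b + 3) j) :
    (univCA R).iter (4 * m) (restConfig m L op d₀) (fun l => S l) =
      restConfig m L op fun β => d₁ (β + 4) := by
  have hm0 : 0 < m := hL.trans_le hm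
  have hm' : (0 : ℤ) < m := by exact_mod_cast hm0
  have e0 : restConfig m L op d₀ = configAt m L op S w₀ d₀ d₁ 0 := by
    funext x
    simp only [configAt, restConfig, Nat.cast_zero, add_zero]
    rw [headBefore_succ hm0, dataAt_pred hm0 h₀ h₁ h₂]
    simp [headAfter, dataAt, letterAt]
    rfl
  -- After `4 * m` steps each datum is exactly four blocks further left, and every head has met its
  -- fourth mark and is idle.
  have e1 : configAt m L op S w₀ d₀ d₁ (4 * m) = restConfig m L op fun β => d₁ (β + 4) := by
    funext x
    simp only [configAt, restConfig]
    rw [headBefore_succ hm0, dataAt_pred hm0 h₀ h₁ h₂]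
    have e2 : (x + ((4 * m : ℕ) : ℤ)) / m = x / m + 4 := by
      push_cast
      exact Int.add_mul_ediv_right _ _ hm'.ne'
    have e3 : (x + ((4 * m : ℕ) : ℤ)) % m = x % m := by
      push_cast
      exact Int.add_mul_emod_self_right _ _ _
    rw [e2, e3]
    simp [headAfter, dataAt, letterAt]
    rfl
  rw [e0, iter_configAt hL hm h₀ h₁ h₂ _ le_rfl, e1]

end Schedule
end Machine
end StochCA

namespace StochCA

/-! ### Passes -/

section Pass

variable {R : Type}

/-- The flag of a pass with walks `γ` over the letters `a`, when it reaches the letter `n`. -/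
def flagAt (γ : ℕ → Walk R) (a : ℕ → Letter R) (s : ℕ → R) : ℕ → Bool
  | 0 => true
  | n + 1 => (γ n (flagAt γ a s n) (a n) (s n)).1

/-- The letters after a pass with walks `γ`. -/
def passOut (γ : ℕ → Walk R) (a : ℕ → Letter R) (s : ℕ → R) (n : ℕ) : Letter R :=
  (γ n (flagAt γ a s n) (a n) (s n)).2

theorem sweep_start {T : ℕ} {w : ℕ → Cell R} {a : ℕ → Letter R} (s : ℕ → R)
    (hw : ∀ n < T, w n = (none, a n)) :
    ∀ n < T, sweep none w s n = (if n = 0 then some true else none, a n) := by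
  intro n hn
  simp [sweep, headStep, hw n hn]

theorem carry_walk {T i : ℕ} {w : ℕ → Cell R} {a : ℕ → Letter R} {φ : Bool} (γ : Walk R)
    (s : ℕ → R) (hw : ∀ n < T, w n = (if n = i then some φ else none, a n)) :
    ∀ n ≤ T, carry (some γ) w s n =
      if n = i + 1 then some (γ φ (a i) (s i)).1 else none := by
  intro n hn
  cases n with
  | zero => simp [carry]
  | succ n =>
    rw [carry, hw n (by omega)]
    by_cases h : n = i
    · simp [headStep, h]
    · simp [headStep, h]

/-- The head picks up the flag at letter `i` and drops it on the next one. If `i + 1 = T`, the flag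
leaves the word, which is then clean for the next pass. -/
theorem sweep_walk {T i : ℕ} {w : ℕ → Cell R} {a : ℕ → Letter R} {φ : Bool} (γ : Walk R)
    (s : ℕ → R) (hw : ∀ n < T, w n = (if n = i then some φ else none, a n)) :
    ∀ n < T, sweep (some γ) w s n = (if n = i + 1 then some (γ φ (a i) (s i)).1 else none,
      if n = i then (γ φ (a i) (s i)).2 else a n) := by
  intro n hn
  rw [sweep, carry_walk γ s hw n hn.le, hw n hn]
  by_cases h : n = i
  · simp [headStep, h]
  · simp [headStep, h]

/-- The program made of the passes with walks `γ 0`, `γ 1`, … over `T` letters. -/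
def passOp (T : ℕ) (γ : ℕ → ℕ → Walk R) (i : ℕ) : Op R :=
  if i % (T + 1) = 0 then none else some (γ (i / (T + 1)) (i % (T + 1) - 1))

theorem passOp_start (T : ℕ) (γ : ℕ → ℕ → Walk R) (p : ℕ) :
    passOp T γ (p * (T + 1)) = none := by
  simp [passOp]

theorem passOp_walk {T : ℕ} (γ : ℕ → ℕ → Walk R) (p : ℕ) {k : ℕ} (hk : k < T) :
    passOp T γ (p * (T + 1) + 1 + k) = some (γ p k) := by
  have h1 : (p * (T + 1) + 1 + k) % (T + 1) = k + 1 := by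
    rw [add_assoc, mul_comm, Nat.mul_add_mod, Nat.mod_eq_of_lt (by omega), add_comm]
  have h2 : (p * (T + 1) + 1 + k) / (T + 1) = p := by
    rw [add_assoc, mul_comm, Nat.mul_add_div (by omega), Nat.div_eq_of_lt (by omega), add_zero]
  simp [passOp, h1, h2]

/-- One head starts the flag and `T` heads walk it. After `k` walks the letters before `k` are
final, and the flag on letter `k` summarizes what has been read. -/
theorem word_pass {m L T : ℕ} {γ : ℕ → ℕ → Walk R} {S : ℕ → ℤ → R} {w₀ : ℤ → ℕ → Cell R} {b : ℤ}
    {p : ℕ} {a : ℕ → Letter R}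
    (h : ∀ n < T, word m L (passOp T γ) S w₀ b (p * (T + 1)) n = (none, a n)) :
    ∀ n < T, word m L (passOp T γ) S w₀ b ((p + 1) * (T + 1)) n =
      (none, passOut (γ p) a (fun n => symbolAt m L S b (p * (T + 1) + 1 + n) n) n) := by
  set σ : ℕ → R := fun n => symbolAt m L S b (p * (T + 1) + 1 + n) n with hσ
  have key : ∀ k ≤ T, ∀ n < T, word m L (passOp T γ) S w₀ b (p * (T + 1) + 1 + k) n =
      (if n = k then some (flagAt (γ p) a σ k) else none,
        if n < k then passOut (γ p) a σ n else a n) := by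
    intro k
    induction k with
    | zero =>
      intro _ n hn
      change sweep (passOp T γ (p * (T + 1))) _ _ n = _
      rw [passOp_start, sweep_start _ h n hn]
      simp [flagAt]
    | succ k ih =>
      intro hk n hn
      rw [← add_assoc]
      change sweep (passOp T γ (p * (T + 1) + 1 + k))
        (word m L (passOp T γ) S w₀ b (p * (T + 1) + 1 + k))
        (symbolAt m L S b (p * (T + 1) + 1 + k)) n = _
      rw [passOp_walk γ p (by omega), sweep_walk _ _ (ih (by omega)) n hn]
      simp only [lt_irrefl, if_false]
      refine Prod.ext rfl ?_
      rcases lt_trichotomy n k with h | h | h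
      · simp [h.ne, h, h.trans (Nat.lt_succ_self k)]
      · subst h
        simp [passOut, hσ]
      · simp [h.ne', not_lt.2 h.le, not_lt.2 (Nat.succ_le_of_lt h)]
  intro n hn
  have e : (p + 1) * (T + 1) = p * (T + 1) + 1 + T := by ring
  rw [e, key T le_rfl n hn]
  simp [hn, hn.ne]

end Pass

/-! ### The program of a local rule -/

section Program

variable {R Q : Type} {L : ℕ} [NeZero L]

/-- The letters of a block with state `x.1` and random symbols `x.2`. -/
def code (enc : Q → Fin L → Bool) (x : Q × (Fin L → R)) (n : ℕ) : Letter R :=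
  (enc x.1 (Fin.ofNat L n), x.2 (Fin.ofNat L n))

/-- The letters of three consecutive blocks. -/
def codeThree (enc : Q → Fin L → Bool) (x y z : Q × (Fin L → R)) (n : ℕ) : Letter R :=
  if n < L then code enc x n else if n < 2 * L then code enc y n else code enc z n

variable {enc : Q → Fin L → Bool}

theorem code_add_mul (x : Q × (Fin L → R)) (κ j : ℕ) :
    code enc x (κ * L + j) = code enc x j := by
  have h : Fin.ofNat L (κ * L + j) = Fin.ofNat L j := by
    apply Fin.ext
    simp [Fin.ofNat]
  rw [code, h, code]

theorem code_injective (henc : Function.Injective enc) {x y : Q × (Fin L → R)}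
    (h : ∀ n < L, code enc x n = code enc y n) : x = y := by
  have h' : ∀ j : Fin L, enc x.1 j = enc y.1 j ∧ x.2 j = y.2 j := by
    intro j
    have := h j j.2
    have e : Fin.ofNat L (j : ℕ) = j := by
      apply Fin.ext
      simp [Fin.ofNat, Nat.mod_eq_of_lt j.2]
    simpa [code, e] using this
  exact Prod.ext (henc (funext fun j => (h' j).1)) (funext fun j => (h' j).2)

theorem codeThree_zero (x y z : Q × (Fin L → R)) {j : ℕ} (hj : j < L) :
    codeThree enc x y z j = code enc x j := by
  simp [codeThree, hj]

theorem codeThree_one (x y z : Q × (Fin L → R)) {j : ℕ} (hj : j < L) :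
    codeThree enc x y z (L + j) = code enc y j := by
  have := code_add_mul (enc := enc) y 1 j
  rw [one_mul] at this
  rw [codeThree, if_neg (by omega), if_pos (by omega), this]

theorem codeThree_two (x y z : Q × (Fin L → R)) (j : ℕ) :
    codeThree enc x y z (2 * L + j) = code enc z j := by
  rw [codeThree, if_neg (by omega), if_neg (by omega), code_add_mul]

theorem codeThree_congr {x y z x' y' z' : Q × (Fin L → R)} {n : ℕ} (hn : n < 2 * L)
    (hx : n < L → code enc x n = code enc x' n)
    (hy : L ≤ n → code enc y n = code enc y' n) :
    codeThree enc x y z n = codeThree enc x' y' z' n := by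
  unfold codeThree
  by_cases h : n < L
  · rw [if_pos h, if_pos h, hx h]
  · rw [if_neg h, if_neg h, if_pos hn, if_pos hn, hy (by omega)]

variable (L) in
/-- The walks that sample the random symbols of the first block. -/
def sampleWalk (n : ℕ) : Walk R :=
  if n < L then fun φ a s => (φ, (a.1, s)) else fun φ a _ => (φ, a)

open scoped Classical in
/-- The walks that compare the first two blocks with `x` and `y`, and write `z` on the third one
in case of equality. -/
noncomputable def entryWalk (enc : Q → Fin L → Bool) (x y z : Q × (Fin L → R)) (n : ℕ) : Walk R :=
  if n < 2 * L then fun φ a _ => (φ && decide (a = codeThree enc x y z n), a)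
  else fun φ a _ => (φ, if φ then code enc z n else a)

theorem passOut_sampleWalk (q : Q) (r : Fin L → R) (y z : Q × (Fin L → R)) (s : ℕ → R) (n : ℕ) :
    passOut (sampleWalk L) (codeThree enc (q, r) y z) s n =
      codeThree enc (q, fun j => s j) y z n := by
  unfold passOut sampleWalk codeThree
  by_cases h : n < L
  · simp [h, code, Nat.mod_eq_of_lt h]
  · simp [h]

open scoped Classical in
-- Over the first `2 * L` letters the flag is the conjunction of the letter comparisons; injectivity
-- of the code turns it into equality of blocks. It is then constant over the third block, which it
-- overwrites or not.
theorem passOut_entryWalk (henc : Function.Injective enc) (x y z x' y' z' : Q × (Fin L → R))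
    (s : ℕ → R) (n : ℕ) :
    passOut (entryWalk enc x' y' z') (codeThree enc x y z) s n =
      codeThree enc x y (if x = x' ∧ y = y' then z' else z) n := by
  have h1 : ∀ n ≤ 2 * L, flagAt (entryWalk enc x' y' z') (codeThree enc x y z) s n =
      decide (∀ k < n, codeThree enc x y z k = codeThree enc x' y' z' k) := by
    intro n
    induction n with
    | zero => simp [flagAt]
    | succ n ih =>
      intro hn
      rw [flagAt, entryWalk, if_pos (by omega), ih (by omega), ← Bool.decide_and]
      refine decide_eq_decide.2 ?_
      constructor
      · rintro ⟨h, h'⟩ k hk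
        rcases Nat.lt_succ_iff_lt_or_eq.1 hk with hk | rfl
        exacts [h k hk, h']
      · exact fun h => ⟨fun k hk => h k (by omega), h n (by omega)⟩
  have h2 : (∀ k < 2 * L, codeThree enc x y z k = codeThree enc x' y' z' k) ↔
      x = x' ∧ y = y' := by
    constructor
    · intro h
      refine ⟨code_injective henc fun j hj => ?_, code_injective henc fun j hj => ?_⟩
      · rw [← codeThree_zero x y z hj, h j (by omega), codeThree_zero _ _ _ hj]
      · rw [← codeThree_one x y z hj, h _ (by omega), codeThree_one _ _ _ hj]
    · rintro ⟨rfl, rfl⟩ k hk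
      exact codeThree_congr hk (fun _ => rfl) fun _ => rfl
  have h3 : ∀ k, flagAt (entryWalk enc x' y' z') (codeThree enc x y z) s (2 * L + k) =
      decide (x = x' ∧ y = y') := by
    intro k
    induction k with
    | zero => rw [add_zero, h1 _ le_rfl, decide_eq_decide.2 h2]
    | succ k ih => rw [← add_assoc, flagAt, entryWalk, if_neg (by omega), ih]
  by_cases hn : n < 2 * L
  · rw [passOut, entryWalk, if_pos hn]
    exact codeThree_congr hn (fun _ => rfl) fun _ => rfl
  · obtain ⟨k, rfl⟩ := Nat.exists_eq_add_of_le (not_lt.1 hn)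
    rw [passOut, entryWalk, if_neg hn, h3]
    rw [codeThree_two, codeThree_two, code_add_mul]
    by_cases hxy : x = x' ∧ y = y'
    · rw [if_pos (decide_eq_true hxy), if_pos hxy]
    · rw [if_neg (by simpa using hxy), if_neg hxy]

/-- The walks of the successive passes of the program of the rule `H`, whose table is listed
by `e`. -/
noncomputable def ruleWalk (enc : Q → Fin L → Bool) (r₀ : R)
    (H : Q × (Fin L → R) → Q × (Fin L → R) → Q) {M : ℕ}
    (e : (Q × (Fin L → R)) × (Q × (Fin L → R)) ≃ Fin M) : ℕ → ℕ → Walk R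
  | 0 => sampleWalk L
  | p + 1 => if h : p < M then
      entryWalk enc (e.symm ⟨p, h⟩).1 (e.symm ⟨p, h⟩).2
        (H (e.symm ⟨p, h⟩).1 (e.symm ⟨p, h⟩).2, fun _ => r₀)
    -- Default never executed: the `m` heads hold exactly `M + 1` passes.
    else sampleWalk L

variable {r₀ : R} {H : Q × (Fin L → R) → Q × (Fin L → R) → Q} {M m : ℕ}
  {e : (Q × (Fin L → R)) × (Q × (Fin L → R)) ≃ Fin M} {S : ℕ → ℤ → R}

/-- After sampling, the first two blocks never change, so exactly one table entry matches them, and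
the third block is overwritten during that pass only. -/
theorem word_rule (henc : Function.Injective enc) {w₀ : ℤ → ℕ → Cell R} {b : ℤ} {q : Q}
    {y z : Q × (Fin L → R)} {r : Fin L → R}
    (h : ∀ n < 3 * L, w₀ b n = (none, codeThree enc (q, fun _ => r₀) y z n))
    (hr : ∀ j : Fin L, symbolAt m L S b (j + 1) j = r j) (n : ℕ) (hn : n < 3 * L) :
    word m L (passOp (3 * L) (ruleWalk enc r₀ H e)) S w₀ b ((M + 1) * (3 * L + 1)) n =
      (none, codeThree enc (q, r) y (H (q, r) y, fun _ => r₀) n) := by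
  classical
  have key : ∀ p ≤ M, ∀ n < 3 * L,
      word m L (passOp (3 * L) (ruleWalk enc r₀ H e)) S w₀ b ((p + 1) * (3 * L + 1)) n =
        (none, codeThree enc (q, r) y
          (if (e ((q, r), y) : ℕ) < p then (H (q, r) y, fun _ => r₀) else z) n) := by
    intro p
    induction p with
    | zero =>
      intro _ n hn
      have h' : ∀ n < 3 * L, word m L (passOp (3 * L) (ruleWalk enc r₀ H e)) S w₀ b
          (0 * (3 * L + 1)) n = (none, codeThree enc (q, fun _ => r₀) y z n) := by
        intro n hn
        rw [zero_mul]
        exact h n hn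
      rw [word_pass h' n hn]
      change (none, passOut (sampleWalk L) _ _ n) = _
      rw [passOut_sampleWalk]
      have hr' : (fun j : Fin L => symbolAt m L S b (0 * (3 * L + 1) + 1 + j) j) = r := by
        funext j
        rw [← hr j, zero_mul, zero_add, add_comm]
      rw [hr', if_neg (Nat.not_lt_zero _)]
    | succ p ih =>
      intro hp n hn
      rw [word_pass (ih (by omega)) n hn]
      have hw : ruleWalk enc r₀ H e (p + 1) = entryWalk enc (e.symm ⟨p, hp⟩).1 (e.symm ⟨p, hp⟩).2
          (H (e.symm ⟨p, hp⟩).1 (e.symm ⟨p, hp⟩).2, fun _ => r₀) := by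
        rw [ruleWalk, dif_pos (Nat.lt_of_succ_le hp)]
      rw [hw, passOut_entryWalk henc]
      congr 2
      by_cases hc : (e ((q, r), y) : ℕ) = p
      · have hc' : e.symm ⟨p, hp⟩ = ((q, r), y) := by
          rw [Equiv.symm_apply_eq]
          exact Fin.ext hc.symm
        rw [hc']
        simp [hc]
      · have hc' : ¬ ((q, r) = (e.symm ⟨p, hp⟩).1 ∧ y = (e.symm ⟨p, hp⟩).2) := by
          rintro ⟨h1, h2⟩
          apply hc
          rw [h1, h2]
          simp
        rw [if_neg hc']
        have : (e ((q, r), y) : ℕ) < p ↔ (e ((q, r), y) : ℕ) < p + 1 := by omega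
        simp only [this]
  rw [key M le_rfl n hn, if_pos (e ((q, r), y)).2]

/-- One run of the program of the rule `H`. -/
theorem iter_rule [Finite R] [Nonempty R] (henc : Function.Injective enc) (c : ℤ → Q)
    (X : ℤ → Q × (Fin L → R))
    (hX : ∀ β, X β = (c β, fun j : Fin L =>
      symbolAt ((M + 1) * (3 * L + 1)) L S (β - 1) (j + 1) j)) :
    (univCA R).iter (4 * ((M + 1) * (3 * L + 1)))
        (restConfig ((M + 1) * (3 * L + 1)) L (passOp (3 * L) (ruleWalk enc r₀ H e))
          fun β j => (none, code enc (c β, fun _ => r₀) j)) (fun l => S l) =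
      restConfig ((M + 1) * (3 * L + 1)) L (passOp (3 * L) (ruleWalk enc r₀ H e))
        fun β j => (none, code enc (H (X (β + 2)) (X (β + 3)), fun _ => r₀) j) := by
  have hL : 0 < L := Nat.pos_of_neZero L
  have hm : L ≤ (M + 1) * (3 * L + 1) := by nlinarith
  -- Each word depends on the output of the program block to its right. This regress is avoided by
  -- giving the words in closed form: only the first block is still unsampled, the other two having
  -- been sampled further right. Consistency is checked afterwards.
  set w₀ : ℤ → ℕ → Cell R := fun b n =>
    (none, codeThree enc (c (b + 1), fun _ => r₀) (X (b + 2)) (X (b + 3)) n) with hw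
  have hword : ∀ b, ∀ n < 3 * L,
      word ((M + 1) * (3 * L + 1)) L (passOp (3 * L) (ruleWalk enc r₀ H e)) S w₀ b
        ((M + 1) * (3 * L + 1)) n = (none, codeThree enc (X (b + 1)) (X (b + 2))
          (H (X (b + 1)) (X (b + 2)), fun _ => r₀) n) := by
    intro b n hn
    rw [word_rule henc (q := c (b + 1)) (y := X (b + 2)) (z := X (b + 3)) (r := (X (b + 1)).2)
      (fun n _ => rfl) ?_ n hn]
    · have : (c (b + 1), (X (b + 1)).2) = X (b + 1) := by rw [hX]
      rw [this]
    · intro j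
      rw [hX, add_sub_cancel_right]
  have := iter_restConfig (R := R) (S := S) (op := passOp (3 * L) (ruleWalk enc r₀ H e)) (w₀ := w₀)
    (d₀ := fun β j => (none, code enc (c β, fun _ => r₀) j))
    (d₁ := fun β j => (none, code enc (H (X (β - 2)) (X (β - 1)), fun _ => r₀) j)) hL hm
    (fun b j hj => by simp only [hw]; rw [codeThree_zero _ _ _ hj])
    (fun b κ hκ j hj => by
      interval_cases κ
      · rw [zero_mul, zero_add, hword b j (by omega), codeThree_zero _ _ _ hj, zero_add, one_mul]
        simp only [hw]
        rw [codeThree_one _ _ _ hj]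
        have e1 : b - 1 + 2 = b + 1 := by ring
        rw [e1]
      · rw [one_mul, hword b _ (by omega), codeThree_one _ _ _ hj]
        simp only [hw]
        have e1 : b - 1 + 3 = b + 2 := by ring
        have e2 : (1 + 1) * L + j = 2 * L + j := by ring
        rw [e2, codeThree_two, e1])
    (fun b j hj => by
      rw [hword b _ (by omega), codeThree_two]
      have e1 : b + 3 - 2 = b + 1 := by ring
      have e2 : b + 3 - 1 = b + 2 := by ring
      rw [e1, e2])
  rw [this]
  congr
  funext β j
  have e1 : β + 4 - 2 = β + 2 := by ring
  have e2 : β + 4 - 1 = β + 3 := by ring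
  rw [e1, e2]

end Program

end StochCA

theorem IsBalanced.of_equiv {X Y : Type*} (e : X ≃ Y) : IsBalanced e :=
  ⟨Unit, e.trans (Equiv.prodPUnit Y).symm, fun _ => rfl⟩

namespace StochCA

/-! ### Universality -/

/-- The universal automaton simulates every automaton whose cells depend on themselves and their
right neighbors only, and whose random symbols can be decoded from those of the universal one. -/
theorem exists_stochSub_univCA {B : StochCA} {R : Type} [Finite R] [Nonempty R] {L : ℕ} [NeZero L]
    (F : B.Q → B.Q → B.R → B.R → B.Q)
    (hF : ∀ c s z, B.global c s z = F (c z) (c (z + 1)) (s z) (s (z + 1)))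
    {enc : B.Q → Fin L → Bool} (henc : Function.Injective enc)
    {g : (Fin L → R) → B.R} (hg : IsBalanced g) :
    ∃ (m t : ℕ+) (k : ℤ), StochSub B ((univCA R).rescale m t k) := by
  classical
  have hL : 0 < L := Nat.pos_of_neZero L
  obtain ⟨M, ⟨e⟩⟩ := Finite.exists_equiv_fin ((B.Q × (Fin L → R)) × (B.Q × (Fin L → R)))
  obtain ⟨r₀⟩ := ‹Nonempty R›
  have : Nonempty R := ⟨r₀⟩
  let H : B.Q × (Fin L → R) → B.Q × (Fin L → R) → B.Q := fun x y => F x.1 y.1 (g x.2) (g y.2)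
  set m : ℕ := (M + 1) * (3 * L + 1) with hm
  have hLm : L + 2 ≤ m := by nlinarith
  have : NeZero m := ⟨by omega⟩
  have hm' : (0 : ℤ) < m := by omega
  let op := passOp (3 * L) (ruleWalk enc r₀ H e)
  let i : B.Q → Fin m → (univCA R).Q := fun q j =>
    (op (m - 1 - j), (3, none), decide ((j : ℕ) = 0),
      if (j : ℕ) < L then some (none, code enc (q, fun _ => r₀) j) else none)
  have hi : Function.Injective i := by
    intro q q' h
    have h1 : (q, fun _ : Fin L => r₀) = (q', fun _ => r₀) := by
      refine code_injective henc fun j hj => ?_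
      have h2 := congrArg (fun x : (univCA R).Q => x.2.2.2) (congrFun h ⟨j, by omega⟩)
      simpa [i, hj] using h2
    exact congrArg Prod.fst h1
  -- In the sampling pass, letter `j` meets head `j + 1` (head `0` places the flag), at time `j + (j
  -- + 1)` and offset `m - 1 - (j + 1)`. These times are distinct, hence `G` is balanced.
  let G : (Fin (4 * m) → Fin m → R) → B.R := fun s =>
    g fun j => s ⟨2 * j + 1, by omega⟩ ⟨m - 2 - j, by omega⟩
  have hG : IsBalanced G := by
    have h1 : IsBalanced fun s : Fin (4 * m) × Fin m → R => s ∘ fun j : Fin L =>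
        ((⟨2 * j + 1, by omega⟩ : Fin (4 * m)), (⟨m - 2 - j, by omega⟩ : Fin m)) := by
      refine IsBalanced.precomp fun j j' h => ?_
      simp only [Prod.mk.injEq, Fin.mk.injEq] at h
      exact Fin.ext (by omega)
    exact hg.comp (h1.comp (IsBalanced.of_equiv (Equiv.curry _ _ _).symm))
  -- A run leaves in block `β` the rule applied at `β + 2`; the shift by `-2 * m` recenters it.
  have hpack : ∀ (c : ℤ → B.Q) (z : ℤ), pack m (shift (-2 * m)
      (restConfig m L op fun β j => (none, code enc (c β, fun _ => r₀) j))) z = i (c (z - 2)) := by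
    intro c z
    funext j
    have h1 : ((m : ℤ) * z + (j : ℕ) + -2 * m) = (j : ℕ) + m * (z - 2) := by ring
    have hj : ((j : ℕ) : ℤ) < m := by exact_mod_cast j.2
    have h2 : ((m : ℤ) * z + (j : ℕ) + -2 * m) / m = z - 2 := by
      rw [h1, Int.add_mul_ediv_left _ _ hm'.ne', Int.ediv_eq_zero_of_lt (by positivity) hj,
        zero_add]
    have h3 : ((m : ℤ) * z + (j : ℕ) + -2 * m) % m = (j : ℕ) := by
      rw [h1, Int.add_mul_emod_self_left, Int.emod_eq_of_lt (by positivity) hj]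
    simp only [pack, shift, restConfig, h2, h3, Int.toNat_natCast]
    rfl
  refine ⟨⟨m, by omega⟩, ⟨4 * m, by omega⟩, -2 * m, ?_⟩
  -- The shift `-1` appears because data block `β` is sampled over program block `β - 1`.
  refine stochSub_of_global_eq (C := (univCA R).rescale m (4 * m) (-2 * m)) i hi hG (-1) ?_
  intro c s z
  refine (congrFun ((univCA R).global_rescale m (4 * m) (-2 * m) _ s) z).trans ?_
  let S : ℕ → ℤ → R := fun τ => if h : τ < 4 * m then unpack m (fun z => s z ⟨τ, h⟩)
    else fun _ => r₀
  have hS : (fun l => unpack m (fun z => s z l)) = fun l : Fin (4 * m) => S l := by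
    funext l
    simp only [S, dif_pos l.2]
    rfl
  have hsym : ∀ (β : ℤ) (j : Fin L), symbolAt m L S (β - 1) (j + 1) j =
      s (β + -1) ⟨2 * j + 1, by omega⟩ ⟨m - 2 - j, by omega⟩ := by
    intro β j
    have hj := j.2
    have e1 : (j : ℕ) / L * m + j % L + (j + 1) = 2 * j + 1 := by
      rw [Nat.div_eq_of_lt hj, Nat.mod_eq_of_lt hj]
      ring
    have e2 : m - 1 - ((j : ℕ) + 1) = m - 2 - j := by omega
    have hlt : ((m - 2 - j : ℕ) : ℤ) < m := by omega
    have e3 : ((β - 1) * m + ((m - 2 - j : ℕ) : ℤ)) / m = β + -1 := by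
      rw [add_comm, Int.add_mul_ediv_right _ _ hm'.ne',
        Int.ediv_eq_zero_of_lt (by positivity) hlt, zero_add]
      ring
    have e4 : ((β - 1) * m + ((m - 2 - j : ℕ) : ℤ)) % m = (m - 2 - j : ℕ) := by
      rw [add_comm, Int.add_mul_emod_self_right, Int.emod_eq_of_lt (by positivity) hlt]
    have e5 : 2 * (j : ℕ) + 1 < 4 * m := by omega
    rw [symbolAt, e1, e2]
    simp only [S, dif_pos e5, unpack, e3, e4, Int.toNat_natCast]
    rfl
  have hrun := iter_rule (R := R) (S := S) (r₀ := r₀) (H := H) (e := e) henc c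
    (fun β => (c β, fun j : Fin L => symbolAt m L S (β - 1) (j + 1) j)) (fun β => rfl)
  simp only [rescaleGlobal]
  rw [hS]
  have hrun' := congrArg (fun d => pack m (shift (-2 * m) d) z) hrun
  refine Eq.trans ?_ (hrun'.trans ?_)
  · rfl
  · refine (hpack (fun β => H (c (β + 2), fun j => symbolAt m L S (β + 2 - 1) (j + 1) j)
      (c (β + 3), fun j => symbolAt m L S (β + 3 - 1) (j + 1) j)) z).trans ?_
    congr 1
    have e1 : z - 2 + 2 = z := by ring
    have e2 : z - 2 + 3 = z + 1 := by ring
    simp only [hF, H, G, e1, e2, hsym]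

theorem exists_global_eq {B : StochCA} (hV : B.V ⊆ {0, 1}) (hV' : B.V' ⊆ {0, 1}) :
    ∃ F : B.Q → B.Q → B.R → B.R → B.Q,
      ∀ c s z, B.global c s z = F (c z) (c (z + 1)) (s z) (s (z + 1)) := by
  refine ⟨fun q q' r r' => B.f (fun v => if (v : ℤ) = 0 then q else q')
    (fun v => if (v : ℤ) = 0 then r else r'), fun c s z => ?_⟩
  simp only [global]
  congr 1
  · funext v
    rcases Finset.mem_insert.1 (hV v.2) with h | h
    · simp [h]
    · simp [Finset.mem_singleton.1 h]
  · funext v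
    rcases Finset.mem_insert.1 (hV' v.2) with h | h
    · simp [h]
    · simp [Finset.mem_singleton.1 h]

/-- Translation by `r` moves the dependency window `[-r, r]` to `[0, 2 * r]`; from a cell of block
`0` it reaches at most `4 * r`, still in block `1`. -/
theorem blockNbhd_subset {N : Finset ℤ} {r : ℕ} (h : ∀ v ∈ N, |v| ≤ r) :
    blockNbhd (2 * r + 1) r N ⊆ {0, 1} := by
  intro x hx
  obtain ⟨⟨j, v⟩, hp, rfl⟩ := Finset.mem_image.1 hx
  obtain ⟨hj, hv⟩ := Finset.mem_product.1 hp
  have hj' := Finset.mem_range.1 hj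
  have hv' := abs_le.1 (h v hv)
  have h0 : (0 : ℤ) < ((2 * r + 1 : ℕ) : ℤ) := by positivity
  have h1 : 0 ≤ ((j : ℤ) + r + v) / ((2 * r + 1 : ℕ) : ℤ) :=
    Int.ediv_nonneg (by omega) h0.le
  have h2 : ((j : ℤ) + r + v) / ((2 * r + 1 : ℕ) : ℤ) < 2 := by
    rw [Int.ediv_lt_iff_lt_mul h0]
    push_cast
    omega
  simp only [Finset.mem_insert, Finset.mem_singleton]
  omega

/-- Grouping cells and translating makes every automaton one-sided of radius one. -/
theorem exists_rescale_nbhd (A : StochCA) :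
    ∃ r : ℕ, (A.rescale (2 * r + 1) 1 r).V ⊆ {0, 1} ∧ (A.rescale (2 * r + 1) 1 r).V' ⊆ {0, 1} := by
  refine ⟨(A.V ∪ A.V').sup Int.natAbs, blockNbhd_subset fun v hv => ?_,
    blockNbhd_subset fun v hv => ?_⟩
  · have hv' : v ∈ A.V := by simpa [iterV, Finset.mem_add] using hv
    rw [Int.abs_eq_natAbs]
    exact_mod_cast Finset.le_sup (f := Int.natAbs) (Finset.mem_union_left _ hv')
  · have hv' : v ∈ A.V' := by simpa [iterV'] using hv
    rw [Int.abs_eq_natAbs]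
    exact_mod_cast Finset.le_sup (f := Int.natAbs) (Finset.mem_union_right _ hv')

theorem simInj_univCA {P : Finset ℕ} {R : Type} [Finite R] [Nonempty R]
    (hR : Nat.card R = ∏ p ∈ P, p) (A : StochCA) (hA : A.PF ⊆ P) : A.SimInj (univCA R) := by
  obtain ⟨r, hV, hV'⟩ := A.exists_rescale_nbhd
  set B := A.rescale (2 * r + 1) 1 r with hB
  obtain ⟨F, hF⟩ := exists_global_eq hV hV'
  -- The radical of `|A.R|` is the product of its primes, all in `P`, so it divides `|R|`.
  obtain ⟨k, hk⟩ : ∃ k, Nat.card A.R ∣ Nat.card R ^ k := by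
    refine (UniqueFactorizationMonoid.exists_dvd_pow_iff_radical_dvd Nat.card_pos.ne').2 ?_
    rw [Nat.radical_eq_prod_primeFactors, hR]
    exact Finset.prod_dvd_prod_of_subset _ _ _ hA
  have hcard : Nat.card B.R = Nat.card A.R ^ (2 * r + 1) := by
    change Nat.card (Fin 1 → Fin (2 * r + 1) → A.R) = _
    simp [Nat.card_fun]
  -- The first term leaves enough bits to encode the states, the second enough random symbols to
  -- decode one of `B`.
  set L := Nat.card B.Q + k * (2 * r + 1) with hL
  have hQ : 0 < Nat.card B.Q := Nat.card_pos
  have : NeZero L := ⟨by omega⟩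
  obtain ⟨enc⟩ : Nonempty (B.Q ↪ (Fin L → Bool)) := by
    cases nonempty_fintype B.Q
    refine Function.Embedding.nonempty_of_card_le ?_
    have h1 := (Nat.lt_two_pow_self (n := L)).le
    rw [← Nat.card_eq_fintype_card, Fintype.card_fun, Fintype.card_bool, Fintype.card_fin]
    omega
  obtain ⟨g, hg⟩ : ∃ g : (Fin L → R) → B.R, IsBalanced g := by
    refine IsBalanced.exists_of_dvd ?_
    rw [hcard, Nat.card_fun, Nat.card_fin]
    refine (pow_dvd_pow_of_dvd hk _).trans ?_
    rw [← pow_mul]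
    exact pow_dvd_pow _ (by omega)
  obtain ⟨m, t, k', h⟩ := exists_stochSub_univCA F hF enc.injective hg
  exact ⟨⟨2 * r + 1, by omega⟩, m, 1, t, r, k', h⟩

end StochCA

theorem theorem6 (P : Finset ℕ) (hP : ∀ p ∈ P, p.Prime) :
    (∃ U : StochCA, U.IsPCA ∧ U.PF = P ∧
      ∀ A : StochCA, A.PF ⊆ P → A.SimInj U ∧ A.SimMix U) ∧
    (∀ p : ℕ, p.Prime → p ∉ P →
      ∃ A : StochCA, A.PF = {p} ∧
        ∀ U : StochCA, U.PF ⊆ P → ¬ A.SimInj U ∧ ¬ A.SimMix U) := by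
  constructor
  · have : NeZero (∏ p ∈ P, p) := ⟨Finset.prod_ne_zero_iff.2 fun p hp => (hP p hp).ne_zero⟩
    have hR : Nat.card (Fin (∏ p ∈ P, p)) = ∏ p ∈ P, p := by simp
    refine ⟨StochCA.univCA (Fin (∏ p ∈ P, p)), rfl, ?_, fun A hA => ?_⟩
    · change (Nat.card (Fin (∏ p ∈ P, p))).primeFactors = P
      rw [hR, Nat.primeFactors_prod hP]
    · have h := StochCA.simInj_univCA hR A hA
      exact ⟨h, h.simMix⟩
  · intro p hp hpP
    have : NeZero p := ⟨hp.ne_zero⟩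
    refine ⟨StochCA.noise p, StochCA.noise_PF hp, fun U hU => ?_⟩
    have h := StochCA.not_simMix_noise hp U fun h => hpP (hU h)
    exact ⟨fun h' => h h'.simMix, h⟩
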